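/- Let $\pi=(\pi^{ij})$ be a smooth Poisson structure on $\mathbb{R}^d$. **Kontsevich trees, symbols, weights.** A Kontsevich graph of type $(n,2)$ has aerial vertices $1,\dots,n$ and terrestrial vertices $\bar 1,\bar 2$; exactly two ordered edges $e_k^1,e_k^2$ leave each aerial vertex $k$, with distinct targets different from $k$, and no edge leaves a terrestrial vertex. It is a Kontsevich tree if the graph formed by its aerial vertices and the edges between them is a tree (connected and without cycles, the orientation being forgotten); $T_{n,2}$ is the set of Kontsevich trees of type $(n,2)$. For such a graph $\Gamma$ with edge set $E_\Gamma$ put $$B_\Gamma(\pi)(f_1,f_2)=\sum_{I:E_\Gamma\to\{1,\dots,d\}}\Big[\prod_{k=1}^n\Big(\prod_{e=(*,k)}\partial_{I(e)}\Big)\pi^{I(e_k^1)I(e_k^2)}\Big]\prod_{a=1}^{2}\Big(\prod_{e=(*,\bar a)}\partial_{I(e)}\Big)f_a ,$$ where $e=(*,v)$ runs over the edges with target $v$, and define the symbol $\hat B_\Gamma(\pi)$ by $B_\Gamma(\pi)(e^{p_1x},e^{p_2x})=\hat B_\Gamma(\pi)(p_1,p_2,x)\,e^{(p_1+p_2)x}$.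 The weight of $\Gamma$ is $$W_\Gamma=\int_{M_n}\bigwedge_{k=1}^n d\phi_k^1\wedge d\phi_k^2 ,$$ where $M_n$ is the space of $n$-tuples $(z_1,\dots,z_n)$ of distinct points of the open upper half plane, oriented by $dx_1\wedge dy_1\wedge\dots\wedge dx_n\wedge dy_n$ with $z_k=x_k+iy_k$; $\phi_k^j=\phi(z_k,z_v)$ if $v$ is the target of $e_k^j$, with $z_{\bar 1}=0$ and $z_{\bar 2}=1$; and $\phi(p,q)=\frac1{2\pi}\arg\frac{q-p}{q-\bar p}\in[0,1)$. **The Kontsevich realization.** Let $$S_{\frac\pi2}(p_1,p_2,x)=(p_1+p_2)x+\sum_{n\ge1}\frac{\epsilon^n}{n!}\sum_{\Gamma\in T_{n,2}}W_\Gamma\,\hat B_\Gamma\big(\tfrac\pi2\big)(p_1,p_2,x),\qquad s_K^i(p,x)=\frac{\partial S_{\frac\pi2}}{\partial p_{2,i}}(p,0,x),$$ formal power series in $\epsilon$ whose coefficients are functions of $(p_1,p_2,x)$ and of $(p,x)$, respectively. **Rooted trees.** A rooted tree is a finite directed graph that is a tree and has a distinguished vertex, the root, towards which all edges are oriented; $[RT]$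 is the set of isomorphism classes of rooted trees. For a rooted tree $t$, let $|t|$ be its number of vertices and $\operatorname{sym}(t)$ its automorphism group. Let $\Gamma_t$ be the Kontsevich tree with interior $t$ such that the first edge of every aerial vertex lands on $\bar 1$, the second edge of the root lands on $\bar 2$, and the second edge of any other vertex is its edge in $t$; put $W_t=W_{\Gamma_t}$. For a vector field $X=X^u\partial_u$ on $\mathbb{R}^d$, the elementary differential is defined recursively by $D_\bullet^uX=X^u$ and, if $t$ is obtained by grafting the roots of $t_1,\dots,t_m$ to a new root, $$D_t^uX=\sum_{i_1,\dots,i_m}\partial_{i_1}\cdots\partial_{i_m}X^u\;D_{t_1}^{i_1}X\cdots D_{t_m}^{i_m}X .$$ **Theorem.** Let $L_V=\sum_{i,j}\pi^{ij}(x)p_i\,\partial_{x^j}$, a vector field on $\mathbb{R}^d$ depending on the parameter $p$. Then, for $i=1,\dots,d$, $$s_K^i(p,x)=x^i+\sum_{t\in[RT]}\epsilon^{|t|}\,\frac{W_t}{|\operatorname{sym}(t)|}\,D_t^iL_V$$ as formal power series in $\epsilon$, where $W_t$, $|\operatorname{sym}(t)|$ and $D_t^iL_V$ are computed from any representative of the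 class $t$. -/

import Mathlib

open scoped ContDiff PowerSeries PowerSeries.WithPiTopology

noncomputable section

/-! ### Partial derivatives and Poisson structures on `ℝ^d` -/

/-- The partial derivative `∂_i f`. -/
def partialDeriv {d : ℕ} (i : Fin d) (f : (Fin d → ℝ) → ℝ) : (Fin d → ℝ) → ℝ :=
  fun x => fderiv ℝ f x (Pi.single i 1)

/-- The iterated partial derivative `∂_{i_1} ⋯ ∂_{i_m} f`. It is only applied to smooth functions,
for which the order of the indices is immaterial. -/
def iterPartialDeriv {d : ℕ} (l : List (Fin d)) (f : (Fin d → ℝ) → ℝ) : (Fin d → ℝ) → ℝ :=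
  l.foldr partialDeriv f

/-- A smooth Poisson structure on `ℝ^d`, given by its components `π^{ij}(x) = coeff x i j`. -/
structure PoissonStructure (d : ℕ) where
  coeff : (Fin d → ℝ) → Fin d → Fin d → ℝ
  smooth : ∀ i j, ContDiff ℝ ∞ (fun x => coeff x i j)
  antisymm : ∀ x i j, coeff x i j = -coeff x j i
  jacobi : ∀ x i j k, ∑ l,
    (coeff x i l * partialDeriv l (fun y => coeff y j k) x
      + coeff x j l * partialDeriv l (fun y => coeff y k i) x
      + coeff x k l * partialDeriv l (fun y => coeff y i j) x) = 0

/-- The vector field `L_V = π^{ij}(x) p_i ∂_{x^j}` on `ℝ^d`, depending on the parameter `p`. -/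
def PoissonStructure.flatSpray {d : ℕ} (π : PoissonStructure d) (p : Fin d → ℝ) :
    (Fin d → ℝ) → Fin d → ℝ :=
  fun x j => ∑ i, π.coeff x i j * p i

/-! ### Oriented trees -/

/-- The directed graph `(V, E)` is a tree: it has no loops and no pair of antiparallel edges (that
would be a cycle of length two), and the underlying undirected graph is connected and acyclic. -/
def IsOrientedTree {V : Type*} (E : V → V → Prop) : Prop :=
  (∀ v w, E v w → ¬ E w v) ∧ (SimpleGraph.fromRel E).IsTree

/-! ### Kontsevich graphs, operators and weights -/

/-- Kontsevich graphs of type `(n, m)`: aerial vertices `Fin n`, terrestrial vertices `Fin m`; the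
target of the edge `e_k^1`, `e_k^2` is `γ k 0`, `γ k 1`. There are no loops, and the two edges
leaving a vertex are different (so they have different targets, since the edges form a subset of
the set of pairs of vertices). -/
def KontsevichGraph (n m : ℕ) : Type :=
  {γ : Fin n → Fin 2 → Fin n ⊕ Fin m // ∀ k, (∀ j, γ k j ≠ Sum.inl k) ∧ γ k 0 ≠ γ k 1}

namespace KontsevichGraph

variable {n m : ℕ}

instance : Fintype (KontsevichGraph n m) := by
  classical
  unfold KontsevichGraph
  infer_instance

/-- The target of the edge `e = (k, j)`, the `j`-th edge leaving the aerial vertex `k`. -/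
def target (Γ : KontsevichGraph n m) (e : Fin n × Fin 2) : Fin n ⊕ Fin m :=
  Γ.1 e.1 e.2

/-- The edges of the interior of `Γ`, i.e. the aerial edges. -/
def interior (Γ : KontsevichGraph n m) (k l : Fin n) : Prop :=
  ∃ j, Γ.target (k, j) = Sum.inl l

/-- `Γ` is a Kontsevich tree. -/
def IsTree (Γ : KontsevichGraph n m) : Prop :=
  IsOrientedTree Γ.interior

open Classical in
/-- The list of the edges landing on the vertex `v`. -/
def incoming (Γ : KontsevichGraph n m) (v : Fin n ⊕ Fin m) : List (Fin n × Fin 2) :=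
  (Finset.univ.filter fun e => Γ.target e = v).toList

/-- The Kontsevich operator `B_Γ(π)(f_1, …, f_m)`. -/
def operator {d : ℕ} (Γ : KontsevichGraph n m) (π : (Fin d → ℝ) → Fin d → Fin d → ℝ)
    (f : Fin m → (Fin d → ℝ) → ℝ) (x : Fin d → ℝ) : ℝ :=
  ∑ I : Fin n × Fin 2 → Fin d,
    (∏ k : Fin n, iterPartialDeriv ((Γ.incoming (Sum.inl k)).map I)
        (fun y => π y (I (k, 0)) (I (k, 1))) x)
      * ∏ a : Fin m, iterPartialDeriv ((Γ.incoming (Sum.inr a)).map I) (f a) x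

/-- The symbol `B̂_Γ(π)(p_1, …, p_m, x)` of `B_Γ(π)`, determined by
`B_Γ(π)(e^{p_1 x}, …, e^{p_m x}) = B̂_Γ(π)(p_1, …, p_m, x) e^{(p_1 + ⋯ + p_m) x}`. -/
def symbol {d : ℕ} (Γ : KontsevichGraph n m) (π : (Fin d → ℝ) → Fin d → Fin d → ℝ)
    (p : Fin m → Fin d → ℝ) (x : Fin d → ℝ) : ℝ :=
  Γ.operator π (fun a y => Real.exp (p a ⬝ᵥ y)) x / Real.exp ((∑ a, p a) ⬝ᵥ x)

end KontsevichGraph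

/-- The angle `φ(p, q) ∈ [0, 1)`, in units of a full turn: the angle at `p`, counted
counterclockwise, from the hyperbolic half-line from `p` to `i∞` to the hyperbolic half-line
from `p` to `q`. For real `q` it is `arg (p - q) / π`. -/
def hyperbolicAngle (p q : ℂ) : ℝ :=
  Int.fract (Complex.arg ((q - p) / (q - starRingEnd ℂ p)) / (2 * Real.pi))

namespace KontsevichGraph

variable {n : ℕ}

/-- The position of a vertex in a configuration `z` of the aerial vertices; the two terrestrial
vertices sit at `0` and `1`. -/
def position (z : Fin n → ℂ) : Fin n ⊕ Fin 2 → ℂ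
  | Sum.inl k => z k
  | Sum.inr a => ((a : ℕ) : ℂ)

/-- The angle function `φ_k^j` of the edge `e = (k, j)` on the configuration space. -/
def edgeAngle (Γ : KontsevichGraph n 2) (e : Fin n × Fin 2) (z : Fin n → ℂ) : ℝ :=
  hyperbolicAngle (z e.1) (position z (Γ.target e))

/-- The manifold of configurations: `n` distinct points in the open upper half plane. -/
def configurations (n : ℕ) : Set (Fin n → ℂ) :=
  {z | (∀ k, 0 < (z k).im) ∧ Function.Injective z}

/-- The coordinate vector fields `∂/∂x_l` (for `b = (l, 0)`) and `∂/∂y_l` (for `b = (l, 1)`) on `ℂ^n`,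
where `z_l = x_l + i y_l`. -/
def coordVector (b : Fin n × Fin 2) : Fin n → ℂ :=
  Pi.single b.1 (![1, Complex.I] b.2)

/-- The coefficient of the angle form `⋀_k dφ_k^1 ∧ dφ_k^2` with respect to
`dx_1 ∧ dy_1 ∧ ⋯ ∧ dx_n ∧ dy_n`. (An angle function jumps by an integer on the null set where the
head of an aerial edge is vertically above its tail; this does not affect the integral below.) -/
def angleForm (Γ : KontsevichGraph n 2) (z : Fin n → ℂ) : ℝ :=
  Matrix.det (Matrix.of fun e b : Fin n × Fin 2 => fderiv ℝ (Γ.edgeAngle e) z (coordVector b))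

/-- The Kontsevich weight `W_Γ`, the integral of the angle form over the configuration space,
oriented by `dx_1 ∧ dy_1 ∧ ⋯ ∧ dx_n ∧ dy_n` (the boundary of its compactification is a null set).
The angles are normalized to `[0, 1)` and there is no factor `1 / n!`. -/
def weight (Γ : KontsevichGraph n 2) : ℝ :=
  ∫ z in configurations n, Γ.angleForm z

end KontsevichGraph

/-! ### The generating function and the Kontsevich realization -/

open Classical in
/-- The formal generating function, a power series in `ε` whose coefficients are functions of
`(p_1, p_2, x)`:
`S_π = (p_1 + p_2) x + ∑_{n ≥ 1} ε^n / n! ∑_{Γ ∈ T_{n,2}} W_Γ B̂_Γ(π)(p_1, p_2, x)`. -/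
def generatingFunction {d : ℕ} (π : (Fin d → ℝ) → Fin d → Fin d → ℝ) :
    ((Fin d → ℝ) → (Fin d → ℝ) → (Fin d → ℝ) → ℝ)⟦X⟧ :=
  PowerSeries.mk fun n p₁ p₂ x =>
    if n = 0 then (p₁ + p₂) ⬝ᵥ x
    else (1 / (n.factorial : ℝ)) *
      ∑ Γ : {Γ : KontsevichGraph n 2 // Γ.IsTree}, Γ.1.weight * Γ.1.symbol π ![p₁, p₂] x

/-- The `i`-th component of the Kontsevich realization `s_K(p, x) = ∂S_{π/2}/∂p_2 (p, 0, x)`, a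
power series in `ε` whose coefficients are functions of `(p, x)`. -/
def kontsevichRealization {d : ℕ} (π : PoissonStructure d) (i : Fin d) :
    ((Fin d → ℝ) → (Fin d → ℝ) → ℝ)⟦X⟧ :=
  PowerSeries.mk fun n p x =>
    partialDeriv i
      (fun p₂ => PowerSeries.coeff n (generatingFunction fun y j k => π.coeff y j k / 2) p p₂ x) 0

/-! ### Rooted trees -/

/-- Rooted trees with vertex set `Fin n`: the head of each edge is nearer to the root than its
tail. -/
structure LabeledRootedTree (n : ℕ) where
  Edge : Fin n → Fin n → Prop
  root : Fin n
  isTree : IsOrientedTree Edge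
  toward_root : ∀ v w, Edge v w →
    (SimpleGraph.fromRel Edge).dist w root < (SimpleGraph.fromRel Edge).dist v root

namespace LabeledRootedTree

variable {n : ℕ}

/-- Isomorphism of rooted trees: a bijection of the vertices that respects the edges (it respects
the root, the only vertex without outgoing edge). -/
instance setoid (n : ℕ) : Setoid (LabeledRootedTree n) where
  r s t := Nonempty (s.Edge ≃r t.Edge)
  iseqv := ⟨fun t => ⟨RelIso.refl t.Edge⟩, fun ⟨f⟩ => ⟨f.symm⟩, fun ⟨f⟩ ⟨g⟩ => ⟨f.trans g⟩⟩

/-- The order of the group of symmetries of `t`. -/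
def symCard (t : LabeledRootedTree n) : ℕ :=
  Nat.card (t.Edge ≃r t.Edge)

theorem exists_edge (t : LabeledRootedTree n) (k : Fin n) (hk : k ≠ t.root) : ∃ w, t.Edge k w := by
  obtain ⟨w, hadj, hd⟩ : ∃ w, (SimpleGraph.fromRel t.Edge).Adj k w ∧
      (SimpleGraph.fromRel t.Edge).dist w t.root < (SimpleGraph.fromRel t.Edge).dist k t.root := by
    obtain ⟨p, hp⟩ := t.isTree.2.1.exists_walk_length_eq_dist k t.root
    cases p with
    | nil => exact absurd rfl hk
    | cons h q =>
      refine ⟨_, h, ?_⟩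
      have := SimpleGraph.dist_le q
      simp only [SimpleGraph.Walk.length_cons] at hp
      omega
  rcases ((SimpleGraph.fromRel_adj _ _ _).1 hadj).2 with h | h
  · exact ⟨w, h⟩
  · exact absurd (t.toward_root _ _ h) (by omega)

/-- The parent of a vertex other than the root. -/
def parent (t : LabeledRootedTree n) (k : Fin n) (hk : k ≠ t.root) : Fin n :=
  (t.exists_edge k hk).choose

theorem edge_parent (t : LabeledRootedTree n) (k : Fin n) (hk : k ≠ t.root) :
    t.Edge k (t.parent k hk) :=
  (t.exists_edge k hk).choose_spec

theorem parent_ne (t : LabeledRootedTree n) (k : Fin n) (hk : k ≠ t.root) : t.parent k hk ≠ k := by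
  intro h
  have h1 := t.edge_parent k hk
  rw [h] at h1
  exact t.isTree.1 k k h1 h1

open Classical in
/-- The Kontsevich tree `Γ_t`: its interior is `t`, the first edge of every vertex lands on the
first terrestrial vertex, and the second edge of the root lands on the second one. -/
def toKontsevichGraph (t : LabeledRootedTree n) : KontsevichGraph n 2 :=
  ⟨fun k j =>
    if j = 0 then Sum.inr 0
    else if hk : k = t.root then Sum.inr 1
    else Sum.inl (t.parent k hk), by
    intro k
    constructor
    · intro j
      by_cases hj : j = 0 <;> by_cases hk : k = t.root <;> simp [hj, hk, parent_ne]
    · by_cases hk : k = t.root <;> simp [hk]⟩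

theorem wellFounded_edge (t : LabeledRootedTree n) : WellFounded t.Edge := by
  let r : Fin n → Fin n → Prop := fun w v =>
    (SimpleGraph.fromRel t.Edge).dist v t.root < (SimpleGraph.fromRel t.Edge).dist w t.root
  have : IsTrans (Fin n) r := ⟨fun _ _ _ h1 h2 => lt_trans h2 h1⟩
  have : Std.Irrefl r := ⟨fun _ h => lt_irrefl _ h⟩
  exact Subrelation.wf (fun {w v} h => t.toward_root w v h)
    (Finite.wellFounded_of_trans_of_irrefl r)

open Classical in
/-- The elementary differential `D_s^u X` of the vector field `X`, where `s` is the subtree of `t`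
formed by the vertex `v` and its descendants. If the children of `v` are `w_1, …, w_m`, then
`s = [s_1, …, s_m]` for the subtrees `s_k` at `w_k`, and
`D_s^u X = ∑ ∂_{i_1} ⋯ ∂_{i_m} X^u · D_{s_1}^{i_1} X ⋯ D_{s_m}^{i_m} X`. -/
def elemDiffAt {d : ℕ} (t : LabeledRootedTree n) (X : (Fin d → ℝ) → Fin d → ℝ) (v : Fin n)
    (u : Fin d) (x : Fin d → ℝ) : ℝ :=
  ∑ i : {w // t.Edge w v} → Fin d,
    iterPartialDeriv ((Finset.univ : Finset {w // t.Edge w v}).toList.map i) (fun y => X y u) x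
      * ∏ w : {w // t.Edge w v}, t.elemDiffAt X w.1 (i w) x
termination_by t.wellFounded_edge.wrap v
decreasing_by exact w.2

/-- The elementary differential `D_t^u X`. -/
def elemDiff {d : ℕ} (t : LabeledRootedTree n) (X : (Fin d → ℝ) → Fin d → ℝ) (u : Fin d)
    (x : Fin d → ℝ) : ℝ :=
  t.elemDiffAt X t.root u x

end LabeledRootedTree

/-- The set `[RT]` of topological rooted trees, i.e. isomorphism classes of rooted trees; the first
component of `T` is its number `|T|` of vertices. -/
def TopRootedTree : Type :=
  Σ n : ℕ, Quotient (LabeledRootedTree.setoid n)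

/-- The degree `|T|`, the number of vertices. -/
def TopRootedTree.degree (T : TopRootedTree) : ℕ := T.1

/-- `t` is a representative of the topological rooted tree `T`. -/
def TopRootedTree.IsRep (T : TopRootedTree) (t : LabeledRootedTree T.degree) : Prop :=
  Quotient.mk (LabeledRootedTree.setoid T.1) t = T.2

end

/-!
Differentiating the symbol `B̂_Γ(ρ)` at `p₂ = 0` leaves only the Kontsevich trees `Γ` with exactly
one edge onto `2̄`. Such a tree has `2n` edges, `n - 1` of them aerial and one onto `2̄`, so `n`
land on `1̄`, which forces exactly one from every aerial vertex. Hence, up to the order of the two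
edges at each aerial vertex, `Γ` is `Γ_t` for a rooted tree `t` on the aerial vertices, and the
contribution of `Γ_t` is the elementary differential of the vector field `ρ^{aj} p_a ∂_j`.
Exchanging the two edges at a vertex changes the sign of the weight and transposes one factor `ρ`
of the operator, so the sum over the `2^n` orders replaces `ρ` by its alternation, which is `π` for
`ρ = π / 2`. Finally, weights and elementary differentials are invariant under renaming the aerial
vertices, and the orbit-stabilizer theorem turns the factor `1 / n!` of the sum over trees on `n`
labeled vertices into `1 / |sym t|` on isomorphism classes.
-/

section Calculus

variable {d : ℕ}

theorem contDiff_partialDeriv {f : (Fin d → ℝ) → ℝ} (hf : ContDiff ℝ ∞ f) (i : Fin d) :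
    ContDiff ℝ ∞ (partialDeriv i f) :=
  (hf.fderiv_right (m := ∞) (by simp)).clm_apply contDiff_const

theorem iterPartialDeriv_cons (i : Fin d) (l : List (Fin d)) (f : (Fin d → ℝ) → ℝ) :
    iterPartialDeriv (i :: l) f = partialDeriv i (iterPartialDeriv l f) := rfl

theorem contDiff_iterPartialDeriv {f : (Fin d → ℝ) → ℝ} (hf : ContDiff ℝ ∞ f)
    (l : List (Fin d)) : ContDiff ℝ ∞ (iterPartialDeriv l f) := by
  induction l with
  | nil => exact hf
  | cons i l ih => exact contDiff_partialDeriv ih i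

theorem partialDeriv_comm {f : (Fin d → ℝ) → ℝ} (hf : ContDiff ℝ 2 f) (i j : Fin d) :
    partialDeriv i (partialDeriv j f) = partialDeriv j (partialDeriv i f) := by
  have hf' : Differentiable ℝ (fderiv ℝ f) :=
    (hf.fderiv_right (m := 1) (by norm_num)).differentiable (by simp)
  have second_eq (a b : Fin d) (x : Fin d → ℝ) : partialDeriv a (partialDeriv b f) x
      = fderiv ℝ (fderiv ℝ f) x (Pi.single a 1) (Pi.single b 1) := by
    unfold partialDeriv
    rw [fderiv_clm_apply (hf' x) (differentiableAt_const _)]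
    simp
  funext x
  rw [second_eq, second_eq]
  exact (hf.contDiffAt.isSymmSndFDerivAt (by simp)).eq _ _

theorem iterPartialDeriv_perm {f : (Fin d → ℝ) → ℝ} (hf : ContDiff ℝ ∞ f) {l l' : List (Fin d)}
    (h : l.Perm l') : iterPartialDeriv l f = iterPartialDeriv l' f := by
  induction h with
  | nil => rfl
  | cons a _ ih => rw [iterPartialDeriv_cons, iterPartialDeriv_cons, ih]
  | swap a b l =>
    have hl : ContDiff ℝ 2 (iterPartialDeriv l f) :=
      (contDiff_iterPartialDeriv hf l).of_le (WithTop.coe_le_coe.2 le_top)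
    exact partialDeriv_comm hl b a
  | trans _ _ ih₁ ih₂ => exact ih₁.trans ih₂

theorem partialDeriv_const_mul (c : ℝ) (i : Fin d) (f : (Fin d → ℝ) → ℝ) :
    partialDeriv i (fun y => c * f y) = fun y => c * partialDeriv i f y := by
  funext x
  exact DFunLike.congr_fun (congrFun (fderiv_const_smul_field (𝕜 := ℝ) (f := f) c) x) _

theorem iterPartialDeriv_const_mul (c : ℝ) (l : List (Fin d)) (f : (Fin d → ℝ) → ℝ) :
    iterPartialDeriv l (fun y => c * f y) = fun y => c * iterPartialDeriv l f y := by
  induction l with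
  | nil => rfl
  | cons i l ih => rw [iterPartialDeriv_cons, ih, partialDeriv_const_mul, iterPartialDeriv_cons]

theorem partialDeriv_sum {ι : Type*} (s : Finset ι) {f : ι → (Fin d → ℝ) → ℝ}
    (hf : ∀ a ∈ s, Differentiable ℝ (f a)) (i : Fin d) :
    partialDeriv i (fun y => ∑ a ∈ s, f a y) = fun y => ∑ a ∈ s, partialDeriv i (f a) y := by
  funext x
  simp only [partialDeriv, fderiv_fun_sum fun a ha => hf a ha x, sum_apply]

theorem iterPartialDeriv_sum {ι : Type*} (s : Finset ι) {f : ι → (Fin d → ℝ) → ℝ}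
    (hf : ∀ a ∈ s, ContDiff ℝ ∞ (f a)) (l : List (Fin d)) :
    iterPartialDeriv l (fun y => ∑ a ∈ s, f a y)
      = fun y => ∑ a ∈ s, iterPartialDeriv l (f a) y := by
  induction l with
  | nil => rfl
  | cons i l ih =>
    rw [iterPartialDeriv_cons, ih, partialDeriv_sum s fun a ha =>
      (contDiff_iterPartialDeriv (hf a ha) l).differentiable (by simp)]
    rfl

theorem contDiff_dotProduct (p : Fin d → ℝ) : ContDiff ℝ ∞ fun y : Fin d → ℝ => p ⬝ᵥ y := by
  unfold dotProduct
  fun_prop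

theorem partialDeriv_dotProduct (p x : Fin d → ℝ) (i : Fin d) :
    partialDeriv i (fun y => p ⬝ᵥ y) x = p i := by
  simp only [dotProduct]
  rw [partialDeriv_sum _ fun j _ => by fun_prop]
  simp only [partialDeriv_const_mul]
  simp [partialDeriv, (hasFDerivAt_apply _ x).fderiv, Pi.single_apply]

theorem iterPartialDeriv_exp_dotProduct (p : Fin d → ℝ) (l : List (Fin d)) :
    iterPartialDeriv l (fun y => Real.exp (p ⬝ᵥ y))
      = fun y => (l.map p).prod * Real.exp (p ⬝ᵥ y) := by
  induction l with
  | nil => simp [iterPartialDeriv]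
  | cons i l ih =>
    have hexp (y : Fin d → ℝ) :
        partialDeriv i (fun y => Real.exp (p ⬝ᵥ y)) y = Real.exp (p ⬝ᵥ y) * p i := by
      rw [← partialDeriv_dotProduct p y i, partialDeriv,
        fderiv_exp ((contDiff_dotProduct p).differentiable (by simp) y)]
      rfl
    rw [iterPartialDeriv_cons, ih, partialDeriv_const_mul]
    funext y
    rw [hexp, List.map_cons, List.prod_cons]
    ring

theorem differentiable_prod_map (l : List (Fin d)) :
    Differentiable ℝ fun q : Fin d → ℝ => (l.map q).prod := by
  induction l with
  | nil => simp
  | cons a l ih =>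
    simp only [List.map_cons, List.prod_cons]
    exact (differentiable_apply a).mul ih

theorem partialDeriv_prod_map_zero (i : Fin d) (l : List (Fin d)) :
    partialDeriv i (fun q => (l.map q).prod) 0 = if l = [i] then 1 else 0 := by
  match l with
  | [] => simp [partialDeriv]
  | [a] => simp [partialDeriv, (hasFDerivAt_apply (𝕜 := ℝ) a (0 : Fin d → ℝ)).fderiv,
      Pi.single_apply]
  | a :: b :: l =>
    have h : HasFDerivAt (fun q : Fin d → ℝ => q a * ((b :: l).map q).prod) _ 0 :=
      (hasFDerivAt_apply a 0).fun_mul (differentiable_prod_map (b :: l) 0).hasFDerivAt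
    change fderiv ℝ (fun q : Fin d → ℝ => q a * ((b :: l).map q).prod) 0 _ = _
    rw [h.fderiv]
    simp

end Calculus

section FormalSums

theorem hasSum_monomial_sigma {R : Type*} [Semiring R] [TopologicalSpace R] {ι : ℕ → Type*}
    [∀ n, Fintype (ι n)] (a : (Σ n, ι n) → R) :
    HasSum (fun T => PowerSeries.monomial T.1 (a T)) (PowerSeries.mk fun n => ∑ T, a ⟨n, T⟩) := by
  rw [PowerSeries.WithPiTopology.hasSum_iff_hasSum_coeff]
  intro n
  rw [PowerSeries.coeff_mk]
  have hzero (T : Σ n, ι n) (hT : T ∉ Set.range (Sigma.mk n)) :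
      PowerSeries.coeff n (PowerSeries.monomial T.1 (a T)) = 0 := by
    rw [PowerSeries.coeff_monomial, if_neg]
    rintro rfl
    exact hT ⟨T.2, rfl⟩
  rw [← sigma_mk_injective.hasSum_iff hzero]
  convert hasSum_fintype _ with T
  simp

end FormalSums

section Alternation

variable {d : ℕ}

/-- The alternation `ρ^{ij} - ρ^{ji}` of a bilinear tensor field. It turns `π / 2` into `π` when `π`
is antisymmetric, which is the origin of the factor `1 / 2` in the Kontsevich realization. -/
def alternation (ρ : (Fin d → ℝ) → Fin d → Fin d → ℝ) : (Fin d → ℝ) → Fin d → Fin d → ℝ :=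
  fun x j k => ρ x j k - ρ x k j

theorem contDiff_alternation {ρ : (Fin d → ℝ) → Fin d → Fin d → ℝ}
    (hρ : ∀ j k, ContDiff ℝ ∞ fun y => ρ y j k) (j k : Fin d) :
    ContDiff ℝ ∞ fun y => alternation ρ y j k :=
  (hρ j k).sub (hρ k j)

theorem alternation_eq_sum_sign (ρ : (Fin d → ℝ) → Fin d → Fin d → ℝ) (a : Fin 2 → Fin d)
    (x : Fin d → ℝ) :
    alternation ρ x (a 0) (a 1)
      = ∑ σ : Equiv.Perm (Fin 2), ((σ.sign : ℤ) : ℝ) * ρ x (a (σ 0)) (a (σ 1)) := by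
  have hperm : (Finset.univ : Finset (Equiv.Perm (Fin 2))) = {1, Equiv.swap 0 1} := by decide
  rw [hperm, Finset.sum_pair (by decide), Equiv.Perm.sign_swap (by decide)]
  simp [alternation, sub_eq_add_neg]

theorem iterPartialDeriv_alternation {ρ : (Fin d → ℝ) → Fin d → Fin d → ℝ}
    (hρ : ∀ j k, ContDiff ℝ ∞ fun y => ρ y j k) (l : List (Fin d)) (a : Fin 2 → Fin d)
    (x : Fin d → ℝ) :
    iterPartialDeriv l (fun y => alternation ρ y (a 0) (a 1)) x
      = ∑ σ : Equiv.Perm (Fin 2),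
        ((σ.sign : ℤ) : ℝ) * iterPartialDeriv l (fun y => ρ y (a (σ 0)) (a (σ 1))) x := by
  simp only [alternation_eq_sum_sign]
  rw [iterPartialDeriv_sum _ fun σ _ => contDiff_const.mul (hρ _ _)]
  simp only [iterPartialDeriv_const_mul]

end Alternation

namespace KontsevichGraph

section Flip

variable {n m d : ℕ}

@[ext]
theorem ext {Γ Γ' : KontsevichGraph n m} (h : ∀ k j, Γ.target (k, j) = Γ'.target (k, j)) :
    Γ = Γ' :=
  Subtype.ext (funext fun k => funext fun j => h k j)

theorem target_injective (Γ : KontsevichGraph n m) (k : Fin n) :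
    Function.Injective fun j => Γ.target (k, j) := by
  intro a b h
  have hne := (Γ.2 k).2
  fin_cases a <;> fin_cases b <;> first | rfl | exact absurd h hne | exact absurd h.symm hne

/-- The graph obtained from `Γ` by permuting the two edges leaving each aerial vertex. -/
def flip (s : Fin n → Equiv.Perm (Fin 2)) (Γ : KontsevichGraph n m) : KontsevichGraph n m :=
  ⟨fun k j => Γ.1 k (s k j), fun k => ⟨fun _ => (Γ.2 k).1 _, fun h => by
    simpa using Γ.target_injective k h⟩⟩

theorem target_flip (s : Fin n → Equiv.Perm (Fin 2)) (Γ : KontsevichGraph n m) (e : Fin n × Fin 2) :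
    (Γ.flip s).target e = Γ.target (Equiv.prodCongrRight s e) := rfl

theorem interior_flip (s : Fin n → Equiv.Perm (Fin 2)) (Γ : KontsevichGraph n m) :
    (Γ.flip s).interior = Γ.interior := by
  funext k l
  exact propext ((s k).exists_congr_right (q := fun j => Γ.target (k, j) = Sum.inl l))

theorem mem_incoming {Γ : KontsevichGraph n m} {v : Fin n ⊕ Fin m} {e : Fin n × Fin 2} :
    e ∈ Γ.incoming v ↔ Γ.target e = v := by
  simp [incoming]

theorem nodup_incoming (Γ : KontsevichGraph n m) (v : Fin n ⊕ Fin m) : (Γ.incoming v).Nodup :=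
  Finset.nodup_toList _

theorem incoming_flip_perm (s : Fin n → Equiv.Perm (Fin 2)) (Γ : KontsevichGraph n m)
    (v : Fin n ⊕ Fin m) :
    (((Γ.flip s).incoming v).map (Equiv.prodCongrRight s)).Perm (Γ.incoming v) := by
  rw [List.perm_ext_iff_of_nodup ((nodup_incoming _ _).map (Equiv.injective _))
    (nodup_incoming _ _)]
  intro e
  obtain ⟨e, rfl⟩ := (Equiv.prodCongrRight s).surjective e
  rw [List.mem_map_of_injective (Equiv.injective _), mem_incoming, mem_incoming, target_flip]

theorem operator_flip {ρ : (Fin d → ℝ) → Fin d → Fin d → ℝ}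
    (hρ : ∀ j k, ContDiff ℝ ∞ fun y => ρ y j k) {f : Fin m → (Fin d → ℝ) → ℝ}
    (hf : ∀ a, ContDiff ℝ ∞ (f a)) (s : Fin n → Equiv.Perm (Fin 2)) (Γ : KontsevichGraph n m)
    (x : Fin d → ℝ) :
    (Γ.flip s).operator ρ f x = ∑ I : Fin n × Fin 2 → Fin d,
      (∏ k, iterPartialDeriv ((Γ.incoming (Sum.inl k)).map I)
          (fun y => ρ y (I (k, s k 0)) (I (k, s k 1))) x)
        * ∏ a, iterPartialDeriv ((Γ.incoming (Sum.inr a)).map I) (f a) x := by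
  symm
  refine Fintype.sum_equiv ((Equiv.prodCongrRight s).symm.arrowCongr (Equiv.refl _)) _ _
    fun I => ?_
  have hI (v : Fin n ⊕ Fin m) : (((Γ.flip s).incoming v).map (I ∘ Equiv.prodCongrRight s)).Perm
      ((Γ.incoming v).map I) := by
    rw [← List.map_map]
    exact (incoming_flip_perm s Γ v).map I
  change _ = (∏ k, iterPartialDeriv (((Γ.flip s).incoming _).map (I ∘ Equiv.prodCongrRight s)) _ x)
    * ∏ a, iterPartialDeriv (((Γ.flip s).incoming _).map (I ∘ Equiv.prodCongrRight s)) _ x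
  simp only [iterPartialDeriv_perm (hρ _ _) (hI _), iterPartialDeriv_perm (hf _) (hI _)]
  rfl

theorem sum_sign_mul_operator_flip {ρ : (Fin d → ℝ) → Fin d → Fin d → ℝ}
    (hρ : ∀ j k, ContDiff ℝ ∞ fun y => ρ y j k) {f : Fin m → (Fin d → ℝ) → ℝ}
    (hf : ∀ a, ContDiff ℝ ∞ (f a)) (Γ : KontsevichGraph n m) (x : Fin d → ℝ) :
    ∑ s : Fin n → Equiv.Perm (Fin 2), (∏ k, (((s k).sign : ℤ) : ℝ)) * (Γ.flip s).operator ρ f x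
      = Γ.operator (alternation ρ) f x := by
  simp only [operator_flip hρ hf, Finset.mul_sum]
  rw [Finset.sum_comm]
  refine Finset.sum_congr rfl fun I _ => ?_
  have expand (k : Fin n) := iterPartialDeriv_alternation hρ ((Γ.incoming (Sum.inl k)).map I)
    (fun j => I (k, j)) x
  rw [Finset.prod_congr rfl fun k _ => expand k, Finset.prod_univ_sum, Fintype.piFinset_univ]
  simp only [Finset.prod_mul_distrib, Finset.sum_mul, mul_assoc]

end Flip

section LinearSymbol

variable {n d : ℕ}

/-- The partial derivative `∂B̂_Γ(ρ)/∂p_{2,i} (p, 0, x)`, the contribution of `Γ` to the `i`-th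
component of the realization. -/
noncomputable def linearSymbol (Γ : KontsevichGraph n 2) (ρ : (Fin d → ℝ) → Fin d → Fin d → ℝ)
    (i : Fin d) (p x : Fin d → ℝ) : ℝ :=
  partialDeriv i (fun q => Γ.symbol ρ ![p, q] x) 0

theorem symbol_eq_sum (Γ : KontsevichGraph n 2) (ρ : (Fin d → ℝ) → Fin d → Fin d → ℝ)
    (p q x : Fin d → ℝ) :
    Γ.symbol ρ ![p, q] x = ∑ I : Fin n × Fin 2 → Fin d,
      (∏ k : Fin n, iterPartialDeriv ((Γ.incoming (Sum.inl k)).map I)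
          (fun y => ρ y (I (k, 0)) (I (k, 1))) x)
        * (((Γ.incoming (Sum.inr 0)).map I).map p).prod
        * (((Γ.incoming (Sum.inr 1)).map I).map q).prod := by
  rw [symbol, operator, Finset.sum_div]
  refine Finset.sum_congr rfl fun I _ => ?_
  rw [div_eq_iff (Real.exp_pos _).ne']
  simp only [Fin.sum_univ_two, Fin.prod_univ_two, Matrix.cons_val_zero, Matrix.cons_val_one,
    iterPartialDeriv_exp_dotProduct, add_dotProduct, Real.exp_add]
  ring

theorem differentiable_symbol (Γ : KontsevichGraph n 2) (ρ : (Fin d → ℝ) → Fin d → Fin d → ℝ)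
    (p x : Fin d → ℝ) : Differentiable ℝ fun q => Γ.symbol ρ ![p, q] x := by
  simp only [symbol_eq_sum]
  exact Differentiable.fun_sum fun I _ => (differentiable_prod_map _).const_mul _

theorem linearSymbol_eq_sum (Γ : KontsevichGraph n 2) (ρ : (Fin d → ℝ) → Fin d → Fin d → ℝ)
    (i : Fin d) (p x : Fin d → ℝ) :
    Γ.linearSymbol ρ i p x = ∑ I : Fin n × Fin 2 → Fin d,
      (∏ k : Fin n, iterPartialDeriv ((Γ.incoming (Sum.inl k)).map I)
          (fun y => ρ y (I (k, 0)) (I (k, 1))) x)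
        * (((Γ.incoming (Sum.inr 0)).map I).map p).prod
        * if (Γ.incoming (Sum.inr 1)).map I = [i] then 1 else 0 := by
  simp only [linearSymbol, symbol_eq_sum]
  rw [partialDeriv_sum _ fun I _ => (differentiable_prod_map _).const_mul _]
  simp only [partialDeriv_const_mul, partialDeriv_prod_map_zero]

theorem linearSymbol_eq_zero {Γ : KontsevichGraph n 2}
    (h : (Γ.incoming (Sum.inr 1)).length ≠ 1) (ρ : (Fin d → ℝ) → Fin d → Fin d → ℝ)
    (i : Fin d) (p x : Fin d → ℝ) : Γ.linearSymbol ρ i p x = 0 := by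
  rw [linearSymbol_eq_sum]
  refine Finset.sum_eq_zero fun I _ => ?_
  rw [if_neg, mul_zero]
  intro hI
  exact h (by simpa using congrArg List.length hI)

theorem sum_sign_mul_linearSymbol_flip {ρ : (Fin d → ℝ) → Fin d → Fin d → ℝ}
    (hρ : ∀ j k, ContDiff ℝ ∞ fun y => ρ y j k) (Γ : KontsevichGraph n 2) (i : Fin d)
    (p x : Fin d → ℝ) :
    ∑ s : Fin n → Equiv.Perm (Fin 2),
        (∏ k, (((s k).sign : ℤ) : ℝ)) * (Γ.flip s).linearSymbol ρ i p x
      = Γ.linearSymbol (alternation ρ) i p x := by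
  have hsymbol (q : Fin d → ℝ) : Γ.symbol (alternation ρ) ![p, q] x
      = ∑ s : Fin n → Equiv.Perm (Fin 2),
        (∏ k, (((s k).sign : ℤ) : ℝ)) * (Γ.flip s).symbol ρ ![p, q] x := by
    simp only [symbol, ← mul_div_assoc, ← Finset.sum_div]
    rw [sum_sign_mul_operator_flip hρ fun a => (contDiff_dotProduct _).exp]
  simp only [linearSymbol, hsymbol]
  rw [partialDeriv_sum _ fun s _ => (differentiable_symbol _ ρ p x).const_mul _]
  simp only [partialDeriv_const_mul]

theorem partialDeriv_sum_weight_mul_symbol {ι : Type*} [Fintype ι] (c : ℝ)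
    (Γ : ι → KontsevichGraph n 2) (ρ : (Fin d → ℝ) → Fin d → Fin d → ℝ) (i : Fin d)
    (p x : Fin d → ℝ) :
    partialDeriv i (fun q => c * ∑ a, (Γ a).weight * (Γ a).symbol ρ ![p, q] x) 0
      = c * ∑ a, (Γ a).weight * (Γ a).linearSymbol ρ i p x := by
  rw [partialDeriv_const_mul,
    partialDeriv_sum _ fun a _ => (differentiable_symbol _ ρ p x).const_mul _]
  simp only [partialDeriv_const_mul, linearSymbol]

end LinearSymbol

section Weight

variable {n : ℕ}

theorem weight_flip (s : Fin n → Equiv.Perm (Fin 2)) (Γ : KontsevichGraph n 2) :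
    (Γ.flip s).weight = (∏ k, (((s k).sign : ℤ) : ℝ)) * Γ.weight := by
  have hform (z : Fin n → ℂ) :
      (Γ.flip s).angleForm z = (∏ k, (((s k).sign : ℤ) : ℝ)) * Γ.angleForm z := by
    have h := Matrix.det_permute (Equiv.prodCongrRight s)
      (Matrix.of fun e b : Fin n × Fin 2 => fderiv ℝ (Γ.edgeAngle e) z (coordVector b))
    rw [Equiv.Perm.sign_prodCongrRight] at h
    push_cast at h
    exact h
  simp only [weight, hform, MeasureTheory.integral_const_mul]

/-- The graph obtained from `Γ` by renaming its aerial vertices. -/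
def relabel (σ : Equiv.Perm (Fin n)) (Γ : KontsevichGraph n 2) : KontsevichGraph n 2 :=
  ⟨fun k j => Sum.map σ id (Γ.1 (σ.symm k) j), fun k => by
    obtain ⟨k, rfl⟩ := σ.surjective k
    have hσ : Function.Injective (Sum.map σ (id : Fin 2 → Fin 2)) :=
      σ.injective.sumMap Function.injective_id
    simpa only [Equiv.symm_apply_apply, ← Sum.map_inl σ (id : Fin 2 → Fin 2), hσ.ne_iff]
      using Γ.2 k⟩

theorem target_relabel (σ : Equiv.Perm (Fin n)) (Γ : KontsevichGraph n 2) (k : Fin n)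
    (j : Fin 2) : (Γ.relabel σ).target (σ k, j) = Sum.map σ id (Γ.target (k, j)) := by
  simp only [target, relabel, Equiv.symm_apply_apply]

/-- The permutation of coordinates moving the point labeled by `k` to the label `σ k`. -/
noncomputable def relabelPoints (σ : Equiv.Perm (Fin n)) : (Fin n → ℂ) ≃L[ℝ] (Fin n → ℂ) :=
  ContinuousLinearEquiv.piCongrLeft ℝ (fun _ => ℂ) σ

theorem relabelPoints_apply (σ : Equiv.Perm (Fin n)) (z : Fin n → ℂ) (k : Fin n) :
    relabelPoints σ z (σ k) = z k :=
  Equiv.piCongrLeft_apply_apply (fun _ : Fin n => ℂ) σ z k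

theorem relabelPoints_preimage_configurations (σ : Equiv.Perm (Fin n)) :
    relabelPoints σ ⁻¹' configurations n = configurations n := by
  ext z
  have hz : relabelPoints σ z ∘ σ = z := funext (relabelPoints_apply σ z)
  have him : (∀ k, 0 < (relabelPoints σ z k).im) ↔ ∀ k, 0 < (z k).im := by
    simp only [← σ.forall_congr_right (q := fun k => 0 < (relabelPoints σ z k).im),
      relabelPoints_apply]
  have hinj : Function.Injective (relabelPoints σ z) ↔ Function.Injective z := by
    rw [← σ.injective_comp, hz]
  exact and_congr him hinj

theorem edgeAngle_relabel (σ : Equiv.Perm (Fin n)) (Γ : KontsevichGraph n 2) (k : Fin n)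
    (j : Fin 2) : (Γ.relabel σ).edgeAngle (σ k, j) ∘ relabelPoints σ = Γ.edgeAngle (k, j) := by
  funext z
  have hposition (v : Fin n ⊕ Fin 2) :
      position (relabelPoints σ z) (Sum.map σ id v) = position z v := by
    cases v <;> simp [position, relabelPoints_apply]
  simp only [edgeAngle, target_relabel, Function.comp_apply, hposition, relabelPoints_apply]

theorem relabelPoints_coordVector (σ : Equiv.Perm (Fin n)) (l : Fin n) (c : Fin 2) :
    relabelPoints σ (coordVector (l, c)) = coordVector (σ l, c) := by
  funext k
  obtain ⟨k, rfl⟩ := σ.surjective k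
  simp [relabelPoints_apply, coordVector, Pi.single_apply]

theorem angleForm_relabel (σ : Equiv.Perm (Fin n)) (Γ : KontsevichGraph n 2) (z : Fin n → ℂ) :
    (Γ.relabel σ).angleForm (relabelPoints σ z) = Γ.angleForm z := by
  unfold angleForm
  rw [← Matrix.det_submatrix_equiv_self (σ.prodCongr (Equiv.refl (Fin 2)))]
  congr 1
  ext ⟨k, j⟩ ⟨l, c⟩
  simp only [Matrix.submatrix_apply, Matrix.of_apply, Equiv.prodCongr_apply, Prod.map,
    Equiv.refl_apply]
  rw [← edgeAngle_relabel σ Γ k j, (relabelPoints σ).comp_right_fderiv,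
    ← relabelPoints_coordVector]
  rfl

theorem weight_relabel (σ : Equiv.Perm (Fin n)) (Γ : KontsevichGraph n 2) :
    (Γ.relabel σ).weight = Γ.weight := by
  have hσ : MeasureTheory.MeasurePreserving (relabelPoints σ) :=
    MeasureTheory.volume_measurePreserving_piCongrLeft (fun _ : Fin n => ℂ) σ
  have h := hσ.setIntegral_preimage_emb (relabelPoints σ).toHomeomorph.measurableEmbedding
    (Γ.relabel σ).angleForm (configurations n)
  rw [relabelPoints_preimage_configurations] at h
  simpa only [weight, angleForm_relabel] using h.symm

end Weight

end KontsevichGraph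

namespace LabeledRootedTree

section Structure

variable {n : ℕ}

theorem Edge.adj {t : LabeledRootedTree n} {v w : Fin n} (h : t.Edge v w) :
    (SimpleGraph.fromRel t.Edge).Adj v w :=
  (SimpleGraph.fromRel_adj _ _ _).2 ⟨fun hvw => t.isTree.1 v w h (hvw ▸ hvw ▸ h), Or.inl h⟩

theorem not_edge_root (t : LabeledRootedTree n) (w : Fin n) : ¬ t.Edge t.root w := fun h => by
  simpa using t.toward_root _ _ h

theorem eq_root_iff (t : LabeledRootedTree n) (v : Fin n) : v = t.root ↔ ∀ w, ¬ t.Edge v w := by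
  refine ⟨fun h w => h ▸ t.not_edge_root w, fun h => ?_⟩
  by_contra hv
  obtain ⟨w, hw⟩ := t.exists_edge v hv
  exact h w hw

@[ext]
theorem ext {s t : LabeledRootedTree n} (h : s.Edge = t.Edge) : s = t := by
  have hroot : s.root = t.root := by rw [t.eq_root_iff, ← h, ← s.eq_root_iff]
  cases s; cases t
  congr

instance : Finite (LabeledRootedTree n) :=
  Finite.of_injective Edge fun _ _ => ext

noncomputable instance : Fintype (LabeledRootedTree n) :=
  Fintype.ofFinite _

theorem exists_isPath_snd_eq {t : LabeledRootedTree n} {v w : Fin n} (h : t.Edge v w) :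
    ∃ p : (SimpleGraph.fromRel t.Edge).Walk v t.root, p.IsPath ∧ p.snd = w := by
  obtain ⟨q, hq, hlength⟩ := t.isTree.2.1.exists_path_of_dist w t.root
  refine ⟨.cons h.adj q, hq.cons fun hv => ?_, by simp⟩
  have hdist := SimpleGraph.dist_le (q.dropUntil v hv)
  have hdrop := q.length_dropUntil_le_length hv
  have hlt := t.toward_root _ _ h
  omega

theorem rightUnique_edge (t : LabeledRootedTree n) : Relator.RightUnique t.Edge := by
  intro v w w' h h'
  obtain ⟨p, hp, rfl⟩ := exists_isPath_snd_eq h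
  obtain ⟨q, hq, rfl⟩ := exists_isPath_snd_eq h'
  rw [(t.isTree.2.existsUnique_path v t.root).unique hp hq]

theorem edge_iff_parent_eq (t : LabeledRootedTree n) {k : Fin n} (hk : k ≠ t.root) (w : Fin n) :
    t.Edge k w ↔ t.parent k hk = w :=
  ⟨fun h => t.rightUnique_edge (t.edge_parent k hk) h, fun h => h ▸ t.edge_parent k hk⟩

theorem dist_root_le_of_reflTransGen {t : LabeledRootedTree n} {k v : Fin n}
    (h : Relation.ReflTransGen t.Edge k v) :
    (SimpleGraph.fromRel t.Edge).dist v t.root ≤ (SimpleGraph.fromRel t.Edge).dist k t.root := by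
  induction h with
  | refl => exact le_rfl
  | tail _ h ih => exact (t.toward_root _ _ h).le.trans ih

theorem not_reflTransGen_of_edge {t : LabeledRootedTree n} {v w : Fin n} (h : t.Edge w v) :
    ¬ Relation.ReflTransGen t.Edge v w := fun h' =>
  (t.toward_root _ _ h).not_ge (dist_root_le_of_reflTransGen h')

theorem reflTransGen_root (t : LabeledRootedTree n) (k : Fin n) :
    Relation.ReflTransGen t.Edge k t.root := by
  induction k using (measure fun k => (SimpleGraph.fromRel t.Edge).dist k t.root).wf.induction with
  | _ k ih =>
    by_cases hk : k = t.root
    · rw [hk]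
    · exact (ih _ (t.toward_root _ _ (t.edge_parent k hk))).head (t.edge_parent k hk)

theorem eq_of_reflTransGen_of_edge {t : LabeledRootedTree n} {v w w' : Fin n} (hw : t.Edge w v)
    (hw' : t.Edge w' v) (h : Relation.ReflTransGen t.Edge w w') : w = w' := by
  rcases h.cases_head with h | ⟨c, hc, h⟩
  · exact h
  · exact absurd (t.rightUnique_edge hc hw ▸ h) (not_reflTransGen_of_edge hw')

end Structure

section Labelings

variable {n : ℕ} {α R : Type*}

/-- The vertices of the subtree of `t` at `v`. -/
abbrev Descendants (t : LabeledRootedTree n) (v : Fin n) : Type :=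
  {k // Relation.ReflTransGen t.Edge k v}

/-- The decomposition of the subtree at `v` into `v` and the subtrees at the children of `v`. -/
noncomputable def descendantsEquiv (t : LabeledRootedTree n) (v : Fin n) :
    Option (Σ w : {w // t.Edge w v}, t.Descendants w) ≃ t.Descendants v :=
  Equiv.ofBijective (fun o => o.elim ⟨v, .refl⟩ fun a => ⟨a.2, a.2.2.tail a.1.2⟩) <| by
    constructor
    · rintro (_ | ⟨w, k, hk⟩) (_ | ⟨w', k', hk'⟩) h
      · rfl
      · obtain rfl : v = k' := congrArg Subtype.val h
        exact absurd hk' (not_reflTransGen_of_edge w'.2)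
      · obtain rfl : k = v := congrArg Subtype.val h
        exact absurd hk (not_reflTransGen_of_edge w.2)
      · obtain rfl : k = k' := congrArg Subtype.val h
        obtain rfl : w = w' := Subtype.ext <| by
          rcases Relation.ReflTransGen.total_of_right_unique t.rightUnique_edge hk hk' with h | h
          · exact eq_of_reflTransGen_of_edge w.2 w'.2 h
          · exact (eq_of_reflTransGen_of_edge w'.2 w.2 h).symm
        rfl
    · rintro ⟨k, hk⟩
      rcases hk.cases_tail with rfl | ⟨w, hkw, hw⟩
      · exact ⟨none, rfl⟩
      · exact ⟨some ⟨⟨w, hw⟩, ⟨k, hkw⟩⟩, rfl⟩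

/-- The decomposition of a labeling of the subtree at `v` into the label of `v` and labelings of the
subtrees at the children of `v`. -/
noncomputable def labelingEquiv (t : LabeledRootedTree n) (v : Fin n) (α : Type*) :
    α × ((w : {w // t.Edge w v}) → t.Descendants w → α) ≃ (t.Descendants v → α) :=
  ((Equiv.piOptionEquivProd (β := fun _ => α)).trans
    (Equiv.prodCongr (Equiv.refl α) (Equiv.piCurry fun _ _ => α))).symm.trans
    (Equiv.arrowCongr (t.descendantsEquiv v) (Equiv.refl α))

theorem labelingEquiv_apply_self (t : LabeledRootedTree n) (v : Fin n) (c : α)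
    (b : (w : {w // t.Edge w v}) → t.Descendants w → α) (h : Relation.ReflTransGen t.Edge v v) :
    t.labelingEquiv v α (c, b) ⟨v, h⟩ = c := by
  have hv : (⟨v, h⟩ : t.Descendants v) = t.descendantsEquiv v none := rfl
  simp only [labelingEquiv, hv, Equiv.trans_apply, Equiv.arrowCongr_apply, Function.comp_apply,
    Equiv.symm_apply_apply]
  rfl

theorem labelingEquiv_apply_child (t : LabeledRootedTree n) (v : Fin n) (c : α)
    (b : (w : {w // t.Edge w v}) → t.Descendants w → α) (w : {w // t.Edge w v})
    (k : t.Descendants w) (h : Relation.ReflTransGen t.Edge k v) :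
    t.labelingEquiv v α (c, b) ⟨k, h⟩ = b w k := by
  have hk : (⟨k, h⟩ : t.Descendants v) = t.descendantsEquiv v (some ⟨w, k⟩) := rfl
  simp only [labelingEquiv, hk, Equiv.trans_apply, Equiv.arrowCongr_apply, Function.comp_apply,
    Equiv.symm_apply_apply]
  rfl

open Classical in
/-- The weight of a labeling `b` of the subtree at `v`: the product over its vertices `k` of a local
factor `F k` depending on the labels of `k` and of the children of `k`. -/
noncomputable def labelingWeight [CommMonoid R] (t : LabeledRootedTree n)
    (F : (k : Fin n) → α → ({w // t.Edge w k} → α) → R) (v : Fin n) (b : t.Descendants v → α) : R :=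
  ∏ k : t.Descendants v, F k (b k) fun w => b ⟨w.1, k.2.head w.2⟩

open Classical in
theorem labelingWeight_labelingEquiv [CommMonoid R] (t : LabeledRootedTree n)
    (F : (k : Fin n) → α → ({w // t.Edge w k} → α) → R) (v : Fin n) (c : α)
    (b : (w : {w // t.Edge w v}) → t.Descendants w → α) :
    t.labelingWeight F v (t.labelingEquiv v α (c, b))
      = F v c (fun w => b w ⟨w.1, .refl⟩)
        * ∏ w : {w // t.Edge w v}, t.labelingWeight F w (b w) := by
  rw [labelingWeight, ← (t.descendantsEquiv v).prod_comp, Fintype.prod_option, Fintype.prod_sigma]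
  congr 1
  · exact congrArg₂ (F v) (labelingEquiv_apply_self ..)
      (funext fun w => labelingEquiv_apply_child t v c b w ⟨w, .refl⟩ _)
  · exact Finset.prod_congr rfl fun w _ => Finset.prod_congr rfl fun k _ =>
      congrArg₂ (F k) (labelingEquiv_apply_child ..)
        (funext fun w' => labelingEquiv_apply_child t v c b w ⟨w', k.2.head w'.2⟩ _)

open Classical in
theorem eq_sum_labelingWeight [Fintype α] [DecidableEq α] [CommSemiring R]
    (t : LabeledRootedTree n)
    {F : (k : Fin n) → α → ({w // t.Edge w k} → α) → R} {Z : Fin n → α → R}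
    (hZ : ∀ v u, Z v u = ∑ i : {w // t.Edge w v} → α, F v u i * ∏ w : {w // t.Edge w v}, Z w (i w))
    (v : Fin n) (u : α) :
    Z v u = ∑ b : t.Descendants v → α, if b ⟨v, .refl⟩ = u then t.labelingWeight F v b else 0 := by
  induction v using t.wellFounded_edge.induction generalizing u with
  | _ v ih =>
    have expand (i : {w // t.Edge w v} → α) : ∏ w : {w // t.Edge w v}, Z w (i w)
        = ∑ b : (w : {w // t.Edge w v}) → t.Descendants w → α,
          if (fun w => b w ⟨w.1, .refl⟩) = i then
            ∏ w : {w // t.Edge w v}, t.labelingWeight F w (b w)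
          else 0 := by
      simp only [fun w : {w // t.Edge w v} => ih w w.2 (i w), Finset.prod_univ_sum,
        Fintype.piFinset_univ, Finset.prod_ite_zero, Finset.mem_univ, true_implies, funext_iff]
    simp only [hZ v u, expand, Finset.mul_sum, mul_ite, mul_zero]
    rw [Finset.sum_comm, ← (t.labelingEquiv v α).sum_comp, Fintype.sum_prod_type_right]
    simp only [labelingEquiv_apply_self, labelingWeight_labelingEquiv, Finset.sum_ite_eq,
      Finset.sum_ite_eq', Finset.mem_univ, if_true]

end Labelings

section ElementaryDifferential

variable {n d : ℕ}

open Classical in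
/-- The list of the children of `v`. -/
noncomputable def childList (t : LabeledRootedTree n) (v : Fin n) : List (Fin n) :=
  (Finset.univ : Finset {w // t.Edge w v}).toList.map Subtype.val

theorem mem_childList {t : LabeledRootedTree n} {v w : Fin n} :
    w ∈ t.childList v ↔ t.Edge w v := by
  simp [childList]

theorem nodup_childList (t : LabeledRootedTree n) (v : Fin n) : (t.childList v).Nodup :=
  (Finset.nodup_toList _).map Subtype.val_injective

theorem elemDiff_eq_sum (t : LabeledRootedTree n) (X : (Fin d → ℝ) → Fin d → ℝ)
    (u : Fin d) (x : Fin d → ℝ) :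
    t.elemDiff X u x = ∑ b : Fin n → Fin d, if b t.root = u then
      ∏ k, iterPartialDeriv ((t.childList k).map b) (fun y => X y (b k)) x else 0 := by
  classical
  have recursion (v : Fin n) (u : Fin d) : t.elemDiffAt X v u x
      = ∑ i : {w // t.Edge w v} → Fin d,
        iterPartialDeriv ((Finset.univ : Finset {w // t.Edge w v}).toList.map i) (fun y => X y u) x
          * ∏ w : {w // t.Edge w v}, t.elemDiffAt X w (i w) x := by
    rw [elemDiffAt]
  rw [elemDiff, t.eq_sum_labelingWeight recursion]
  let e : t.Descendants t.root ≃ Fin n := Equiv.subtypeUnivEquiv t.reflTransGen_root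
  refine Fintype.sum_equiv (Equiv.arrowCongr e (Equiv.refl _)) _ _ fun b => ?_
  refine if_congr Iff.rfl (Fintype.prod_equiv e _ _ fun k => ?_) rfl
  simp only [childList, List.map_map]
  rfl

end ElementaryDifferential

end LabeledRootedTree

section Reorientation

variable {V : Type*} {E : V → V → Prop}

theorem edge_snd_of_isPath (hE : Relator.RightUnique E) {r : V} (hr : ∀ w, ¬ E r w) {v : V}
    {p : (SimpleGraph.fromRel E).Walk v r} (hp : p.IsPath) (hnil : ¬ p.Nil) : E v p.snd := by
  induction p with
  | nil => simp at hnil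
  | @cons v a r h q ih =>
    rw [SimpleGraph.Walk.snd_cons]
    rcases ((SimpleGraph.fromRel_adj _ _ _).1 h).2 with h | h
    · exact h
    · rw [SimpleGraph.Walk.cons_isPath_iff] at hp
      have hq : ¬ q.Nil := fun hq => hr v (hq.eq ▸ h)
      have hsnd : q.snd = v := hE (ih hr hp.1 hq) h
      exact absurd (hsnd ▸ q.getVert_mem_support 1) hp.2

theorem dist_lt_dist_of_edge (hconn : (SimpleGraph.fromRel E).Connected)
    (hE : Relator.RightUnique E) {r : V} (hr : ∀ w, ¬ E r w) {v w : V} (h : E v w) :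
    (SimpleGraph.fromRel E).dist w r < (SimpleGraph.fromRel E).dist v r := by
  obtain ⟨p, hp, hlength⟩ := hconn.exists_path_of_dist v r
  have hnil : ¬ p.Nil := fun hnil => hr w (hnil.eq ▸ h)
  obtain rfl : w = p.snd := hE h (edge_snd_of_isPath hE hr hp hnil)
  have htail := SimpleGraph.dist_le p.tail
  have hlength_tail := p.length_tail_add_one hnil
  omega

theorem IsOrientedTree.comap {W : Type*} (hE : IsOrientedTree E) (f : W ≃ V) :
    IsOrientedTree fun v w => E (f v) (f w) :=
  ⟨fun v w => hE.1 (f v) (f w),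
    (SimpleGraph.Iso.isTree_iff (G' := SimpleGraph.fromRel E) ⟨f, by simp⟩).2 hE.2⟩

end Reorientation

section Orbits

theorem sum_div_card_eq_sum_quotient {G X K : Type*} [Group G] [Finite G] [MulAction G X]
    [Fintype X] [Field K] [CharZero K] {s : Setoid X} [Fintype (Quotient s)]
    (hs : s = MulAction.orbitRel G X) {φ : X → K} (hφ : ∀ (g : G) x, φ (g • x) = φ x)
    {rep : Quotient s → X} (hrep : ∀ q, ⟦rep q⟧ = q) :
    (∑ x, φ x) / Nat.card G = ∑ q, φ (rep q) / Nat.card (MulAction.stabilizer G (rep q)) := by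
  classical
  rw [← Finset.sum_fiberwise Finset.univ fun x => (⟦x⟧ : Quotient s), Finset.sum_div]
  refine Finset.sum_congr rfl fun q _ => ?_
  have mem_orbit (x : X) : ⟦x⟧ = q ↔ x ∈ MulAction.orbit G (rep q) := by
    rw [← MulAction.orbitRel_apply, ← hs, ← Quotient.eq, hrep]
  have hconst (x : X) (hx : x ∈ Finset.univ.filter fun x => ⟦x⟧ = q) : φ x = φ (rep q) := by
    obtain ⟨g, rfl⟩ := (mem_orbit x).1 (Finset.mem_filter.1 hx).2
    exact hφ g _
  have hfiber : (Finset.univ.filter fun x => ⟦x⟧ = q).card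
      = (MulAction.stabilizer G (rep q)).index := by
    rw [MulAction.index_stabilizer, ← Set.ncard_coe_finset]
    congr 1
    ext x
    simp [mem_orbit]
  have hcard : (Nat.card G : K)
      = Nat.card (MulAction.stabilizer G (rep q)) * (MulAction.stabilizer G (rep q)).index := by
    exact_mod_cast (Subgroup.card_mul_index _).symm
  have hindex : ((MulAction.stabilizer G (rep q)).index : K) ≠ 0 :=
    Nat.cast_ne_zero.2 Subgroup.index_ne_zero_of_finite
  rw [Finset.sum_congr rfl hconst, Finset.sum_const, nsmul_eq_mul, hfiber, hcard, mul_comm,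
    mul_div_mul_right _ _ hindex]

end Orbits

namespace LabeledRootedTree

section Relabeling

variable {n d : ℕ}

instance : MulAction (Equiv.Perm (Fin n)) (LabeledRootedTree n) where
  smul σ t :=
    { Edge := fun v w => t.Edge (σ⁻¹ v) (σ⁻¹ w)
      root := σ t.root
      isTree := t.isTree.comap σ⁻¹
      toward_root := fun _ _ => dist_lt_dist_of_edge (t.isTree.comap σ⁻¹).2.1
        (fun _ _ _ h h' => σ⁻¹.injective (t.rightUnique_edge h h'))
        fun w => by simpa using t.not_edge_root _ }
  one_smul _ := rfl
  mul_smul _ _ _ := rfl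

theorem smul_root (σ : Equiv.Perm (Fin n)) (t : LabeledRootedTree n) :
    (σ • t).root = σ t.root := rfl

theorem smul_edge_apply (σ : Equiv.Perm (Fin n)) (t : LabeledRootedTree n) (v w : Fin n) :
    (σ • t).Edge (σ v) (σ w) ↔ t.Edge v w := by
  change t.Edge (σ⁻¹ (σ v)) (σ⁻¹ (σ w)) ↔ _
  simp

theorem smul_eq_iff {σ : Equiv.Perm (Fin n)} {s t : LabeledRootedTree n} :
    σ • s = t ↔ ∀ v w, t.Edge (σ v) (σ w) ↔ s.Edge v w := by
  refine ⟨fun h v w => h ▸ smul_edge_apply σ s v w, fun h => LabeledRootedTree.ext ?_⟩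
  funext v w
  obtain ⟨v, rfl⟩ := σ.surjective v
  obtain ⟨w, rfl⟩ := σ.surjective w
  rw [eq_iff_iff, smul_edge_apply, h]

theorem setoid_eq_orbitRel (n : ℕ) :
    setoid n = MulAction.orbitRel (Equiv.Perm (Fin n)) (LabeledRootedTree n) := by
  ext s t
  refine ⟨fun ⟨f⟩ => Setoid.symm' _ ⟨f.toEquiv, smul_eq_iff.2 fun _ _ => f.map_rel_iff⟩, ?_⟩
  intro h
  obtain ⟨σ, hσ⟩ := Setoid.symm' _ h
  exact ⟨⟨σ, smul_eq_iff.1 hσ _ _⟩⟩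

theorem card_stabilizer (t : LabeledRootedTree n) :
    Nat.card (MulAction.stabilizer (Equiv.Perm (Fin n)) t) = t.symCard :=
  Nat.card_congr
    { toFun := fun σ => ⟨σ.1, smul_eq_iff.1 σ.2 _ _⟩
      invFun := fun f => ⟨f.toEquiv, smul_eq_iff.2 fun _ _ => f.map_rel_iff⟩
      left_inv := fun _ => rfl
      right_inv := fun _ => rfl }

theorem childList_smul_perm (σ : Equiv.Perm (Fin n)) (t : LabeledRootedTree n) (k : Fin n) :
    ((σ • t).childList (σ k)).Perm ((t.childList k).map σ) := by
  rw [List.perm_ext_iff_of_nodup (nodup_childList _ _) ((nodup_childList _ _).map σ.injective)]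
  intro w
  obtain ⟨w, rfl⟩ := σ.surjective w
  rw [mem_childList, smul_edge_apply, List.mem_map_of_injective σ.injective, mem_childList]

theorem elemDiff_smul (σ : Equiv.Perm (Fin n)) (t : LabeledRootedTree n)
    {X : (Fin d → ℝ) → Fin d → ℝ} (hX : ∀ u, ContDiff ℝ ∞ fun y => X y u) (u : Fin d)
    (x : Fin d → ℝ) : (σ • t).elemDiff X u x = t.elemDiff X u x := by
  rw [elemDiff_eq_sum, elemDiff_eq_sum]
  refine Fintype.sum_equiv (σ.symm.arrowCongr (Equiv.refl _)) _ _ fun b => ?_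
  change _ = if b (σ t.root) = u then
    ∏ k, iterPartialDeriv ((t.childList k).map (b ∘ σ)) (fun y => X y (b (σ k))) x else 0
  refine if_congr Iff.rfl (Fintype.prod_equiv σ.symm _ _ fun k => ?_) rfl
  obtain ⟨k, rfl⟩ := σ.surjective k
  rw [Equiv.symm_apply_apply, ← List.map_map]
  exact congrFun (iterPartialDeriv_perm (hX _) ((childList_smul_perm σ t k).map b)) x

end Relabeling

section KontsevichTree

variable {n d : ℕ}

theorem target_toKontsevichGraph_zero (t : LabeledRootedTree n) (k : Fin n) :
    t.toKontsevichGraph.target (k, 0) = Sum.inr 0 := by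
  simp [toKontsevichGraph, KontsevichGraph.target]

theorem target_toKontsevichGraph_root (t : LabeledRootedTree n) :
    t.toKontsevichGraph.target (t.root, 1) = Sum.inr 1 := by
  simp [toKontsevichGraph, KontsevichGraph.target]

theorem target_toKontsevichGraph_of_edge {t : LabeledRootedTree n} {k l : Fin n}
    (h : t.Edge k l) : t.toKontsevichGraph.target (k, 1) = Sum.inl l := by
  have hk : k ≠ t.root := fun hk => (t.eq_root_iff k).1 hk l h
  simpa [toKontsevichGraph, KontsevichGraph.target, hk] using (t.edge_iff_parent_eq hk l).1 h

theorem toKontsevichGraph_eq_of_target {t : LabeledRootedTree n} {Γ : KontsevichGraph n 2}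
    (hzero : ∀ k, Γ.target (k, 0) = Sum.inr 0) (hroot : Γ.target (t.root, 1) = Sum.inr 1)
    (hedge : ∀ k l, t.Edge k l → Γ.target (k, 1) = Sum.inl l) : t.toKontsevichGraph = Γ := by
  refine KontsevichGraph.ext fun k j => ?_
  fin_cases j
  · exact (t.target_toKontsevichGraph_zero k).trans (hzero k).symm
  · by_cases hk : k = t.root
    · subst hk
      exact t.target_toKontsevichGraph_root.trans hroot.symm
    · have h := t.edge_parent k hk
      exact (target_toKontsevichGraph_of_edge h).trans (hedge _ _ h).symm

theorem target_toKontsevichGraph_one_eq_inl (t : LabeledRootedTree n) (k l : Fin n) :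
    t.toKontsevichGraph.target (k, 1) = Sum.inl l ↔ t.Edge k l := by
  refine ⟨fun h => ?_, target_toKontsevichGraph_of_edge⟩
  have hk : k ≠ t.root := by
    rintro rfl
    simp [target_toKontsevichGraph_root] at h
  have hparent := t.edge_parent k hk
  rwa [target_toKontsevichGraph_of_edge hparent, Sum.inl_injective.eq_iff,
    ← t.edge_iff_parent_eq hk] at h

theorem target_toKontsevichGraph_one_eq_inr_one (t : LabeledRootedTree n) (k : Fin n) :
    t.toKontsevichGraph.target (k, 1) = Sum.inr 1 ↔ k = t.root := by
  refine ⟨fun h => ?_, fun h => h ▸ t.target_toKontsevichGraph_root⟩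
  by_contra hk
  simp [target_toKontsevichGraph_of_edge (t.edge_parent k hk)] at h

theorem interior_toKontsevichGraph (t : LabeledRootedTree n) :
    t.toKontsevichGraph.interior = t.Edge := by
  funext k l
  simp [KontsevichGraph.interior, Fin.exists_fin_two, target_toKontsevichGraph_zero,
    target_toKontsevichGraph_one_eq_inl]

theorem toKontsevichGraph_smul (σ : Equiv.Perm (Fin n)) (t : LabeledRootedTree n) :
    (σ • t).toKontsevichGraph = t.toKontsevichGraph.relabel σ := by
  refine toKontsevichGraph_eq_of_target (fun k => ?_) ?_ fun k l h => ?_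
  · obtain ⟨k, rfl⟩ := σ.surjective k
    rw [KontsevichGraph.target_relabel, target_toKontsevichGraph_zero, Sum.map_inr, id]
  · rw [smul_root, KontsevichGraph.target_relabel, target_toKontsevichGraph_root, Sum.map_inr, id]
  · obtain ⟨k, rfl⟩ := σ.surjective k
    obtain ⟨l, rfl⟩ := σ.surjective l
    rw [smul_edge_apply] at h
    rw [KontsevichGraph.target_relabel, target_toKontsevichGraph_of_edge h, Sum.map_inl]

theorem incoming_inl_perm (t : LabeledRootedTree n) (k : Fin n) :
    (t.toKontsevichGraph.incoming (Sum.inl k)).Perm ((t.childList k).map fun w => (w, 1)) := by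
  rw [List.perm_ext_iff_of_nodup (KontsevichGraph.nodup_incoming _ _)
    ((nodup_childList _ _).map (Prod.mk_left_injective 1))]
  rintro ⟨w, j⟩
  rw [KontsevichGraph.mem_incoming]
  fin_cases j
  · simp [target_toKontsevichGraph_zero]
  · simp [target_toKontsevichGraph_one_eq_inl, mem_childList]

theorem incoming_inr_zero_perm (t : LabeledRootedTree n) :
    (t.toKontsevichGraph.incoming (Sum.inr 0)).Perm ((List.finRange n).map fun w => (w, 0)) := by
  rw [List.perm_ext_iff_of_nodup (KontsevichGraph.nodup_incoming _ _)
    ((List.nodup_finRange n).map (Prod.mk_left_injective 0))]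
  rintro ⟨w, j⟩
  rw [KontsevichGraph.mem_incoming]
  have hzero := t.target_toKontsevichGraph_zero w
  fin_cases j
  · simpa using hzero
  · simpa using fun hone => zero_ne_one
      (t.toKontsevichGraph.target_injective w (hzero.trans hone.symm))

theorem incoming_inr_one (t : LabeledRootedTree n) :
    t.toKontsevichGraph.incoming (Sum.inr 1) = [(t.root, 1)] := by
  rw [← List.perm_singleton, List.perm_ext_iff_of_nodup (KontsevichGraph.nodup_incoming _ _)
    (List.nodup_singleton _)]
  rintro ⟨w, j⟩
  rw [KontsevichGraph.mem_incoming]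
  fin_cases j
  · simp [target_toKontsevichGraph_zero]
  · simp [target_toKontsevichGraph_one_eq_inr_one]

theorem flip_toKontsevichGraph_injective : Function.Injective
    fun a : LabeledRootedTree n × (Fin n → Equiv.Perm (Fin 2)) =>
      a.1.toKontsevichGraph.flip a.2 := by
  rintro ⟨t, s⟩ ⟨t', s'⟩ (h : t.toKontsevichGraph.flip s = t'.toKontsevichGraph.flip s')
  have hinterior := congrArg KontsevichGraph.interior h
  simp only [KontsevichGraph.interior_flip, interior_toKontsevichGraph] at hinterior
  obtain rfl := LabeledRootedTree.ext hinterior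
  refine Prod.ext rfl (funext fun k => Equiv.ext fun j => ?_)
  exact t.toKontsevichGraph.target_injective k (congrArg (fun Γ => Γ.target (k, j)) h)

end KontsevichTree

end LabeledRootedTree

namespace KontsevichGraph

section Classification

variable {n m : ℕ}

theorem exists_toKontsevichGraph_eq {Γ : KontsevichGraph n 2} (hΓ : Γ.IsTree)
    (hzero : ∀ k, Γ.target (k, 0) = Sum.inr 0)
    (hone : (Γ.incoming (Sum.inr 1)).length = 1) :
    ∃ t : LabeledRootedTree n, t.toKontsevichGraph = Γ := by
  obtain ⟨⟨r, j⟩, hr⟩ := List.length_eq_one_iff.1 hone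
  have htarget : Γ.target (r, j) = Sum.inr 1 := mem_incoming.1 (hr ▸ List.mem_singleton_self _)
  obtain rfl : j = 1 := by
    by_contra hj
    obtain rfl : j = 0 := by omega
    simp [hzero] at htarget
  have hinterior (k l : Fin n) : Γ.interior k l ↔ Γ.target (k, 1) = Sum.inl l := by
    simp [interior, Fin.exists_fin_two, hzero]
  have hunique : Relator.RightUnique Γ.interior := fun v w w' h h' =>
    Sum.inl_injective (((hinterior v w).1 h).symm.trans ((hinterior v w').1 h'))
  have hroot (w : Fin n) : ¬ Γ.interior r w := by simp [hinterior, htarget]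
  let t : LabeledRootedTree n := ⟨Γ.interior, r, hΓ, fun _ _ =>
    dist_lt_dist_of_edge hΓ.2.1 hunique hroot⟩
  exact ⟨t, LabeledRootedTree.toKontsevichGraph_eq_of_target hzero htarget
    fun k l => (hinterior k l).1⟩

theorem IsTree.card_aerial_edges_lt {Γ : KontsevichGraph n m} (hΓ : Γ.IsTree) :
    (Finset.univ.filter fun e => (Γ.target e).isLeft).card < n := by
  classical
  have hedges := hΓ.2.card_edgeFinset
  rw [Fintype.card_fin] at hedges
  refine (Nat.lt_succ_of_le ?_).trans_eq hedges
  refine Finset.card_le_card_of_injOn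
    (fun e => s(e.1, (Γ.target e).elim id fun _ => e.1)) ?_ ?_
  · rintro ⟨k, j⟩ he
    obtain ⟨l, hl⟩ := Sum.isLeft_iff.1 (Finset.mem_filter.1 he).2
    have hne : k ≠ l := fun h => (Γ.2 k).1 j (h ▸ hl)
    simpa [hl, hne] using Or.inl ⟨j, hl⟩
  · rintro ⟨k, j⟩ he ⟨k', j'⟩ he' h
    obtain ⟨l, hl⟩ := Sum.isLeft_iff.1 (Finset.mem_filter.1 he).2
    obtain ⟨l', hl'⟩ := Sum.isLeft_iff.1 (Finset.mem_filter.1 he').2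
    simp only [hl, hl', Sum.elim_inl, id, Sym2.eq_iff] at h
    rcases h with ⟨rfl, rfl⟩ | ⟨rfl, rfl⟩
    · exact Prod.ext rfl (Γ.target_injective k (hl.trans hl'.symm))
    · exact absurd ⟨j', hl'⟩ (hΓ.1 k l ⟨j, hl⟩)

theorem nodup_map_fst_incoming (Γ : KontsevichGraph n m) (v : Fin n ⊕ Fin m) :
    ((Γ.incoming v).map Prod.fst).Nodup := by
  refine (Γ.nodup_incoming v).map_on ?_
  rintro ⟨k, j⟩ he ⟨k', j'⟩ he' (rfl : k = k')
  exact Prod.ext rfl (Γ.target_injective k ((mem_incoming.1 he).trans (mem_incoming.1 he').symm))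

theorem length_incoming (Γ : KontsevichGraph n m) (v : Fin n ⊕ Fin m) :
    (Γ.incoming v).length = (Finset.univ.filter fun e => Γ.target e = v).card := by
  classical
  rw [incoming, Finset.length_toList]

theorem card_edges (Γ : KontsevichGraph n m) :
    2 * n = (Finset.univ.filter fun e => (Γ.target e).isLeft).card
      + ∑ a, (Γ.incoming (Sum.inr a)).length := by
  classical
  have hcard : 2 * n = (Finset.univ : Finset (Fin n × Fin 2)).card := by simp [mul_comm]
  rw [hcard, ← Finset.card_filter_add_card_filter_not fun e => (Γ.target e).isLeft]
  simp only [length_incoming]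
  rw [← Finset.card_biUnion fun a _ b _ hab => Finset.disjoint_filter.2 fun e _ ha hb =>
    hab (Sum.inr_injective (ha.symm.trans hb))]
  congr 2
  ext e
  simp [Sum.isRight_iff]

theorem exists_target_eq_inr_zero {Γ : KontsevichGraph n 2} (hΓ : Γ.IsTree)
    (hone : (Γ.incoming (Sum.inr 1)).length = 1) (k : Fin n) :
    ∃ j, Γ.target (k, j) = Sum.inr 0 := by
  classical
  have hle : n ≤ (Γ.incoming (Sum.inr 0)).length := by
    have hcard := Γ.card_edges
    have hlt := hΓ.card_aerial_edges_lt
    rw [Fin.sum_univ_two] at hcard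
    omega
  have hsurj : ((Γ.incoming (Sum.inr 0)).map Prod.fst).toFinset = Finset.univ := by
    refine Finset.eq_univ_of_card _ (le_antisymm (Finset.card_le_univ _) ?_)
    rwa [List.toFinset_card_of_nodup (Γ.nodup_map_fst_incoming _), List.length_map,
      Fintype.card_fin]
  obtain ⟨⟨k, j⟩, he, rfl⟩ := List.mem_map.1 (List.mem_toFinset.1 (hsurj ▸ Finset.mem_univ k))
  exact ⟨j, mem_incoming.1 he⟩

theorem exists_flip_toKontsevichGraph_eq {Γ : KontsevichGraph n 2} (hΓ : Γ.IsTree)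
    (hone : (Γ.incoming (Sum.inr 1)).length = 1) :
    ∃ (t : LabeledRootedTree n) (s : Fin n → Equiv.Perm (Fin 2)),
      t.toKontsevichGraph.flip s = Γ := by
  choose j hj using exists_target_eq_inr_zero hΓ hone
  let s : Fin n → Equiv.Perm (Fin 2) := fun k => Equiv.swap 0 (j k)
  have hzero (k : Fin n) : (Γ.flip s).target (k, 0) = Sum.inr 0 := by
    simp [target_flip, s, hj]
  obtain ⟨t, ht⟩ := exists_toKontsevichGraph_eq (by rwa [IsTree, interior_flip]) hzero
    (by rwa [← (incoming_flip_perm s Γ _).length_eq, List.length_map] at hone)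
  refine ⟨t, s, ext fun k j => ?_⟩
  rw [ht]
  simp [target_flip, s]

theorem isTree_flip_toKontsevichGraph (t : LabeledRootedTree n)
    (s : Fin n → Equiv.Perm (Fin 2)) : (t.toKontsevichGraph.flip s).IsTree := by
  rw [IsTree, interior_flip, t.interior_toKontsevichGraph]
  exact t.isTree

open Classical in
theorem sum_isTree_eq_sum_flip {M : Type*} [AddCommMonoid M] {F : KontsevichGraph n 2 → M}
    (hF : ∀ Γ : KontsevichGraph n 2, (Γ.incoming (Sum.inr 1)).length ≠ 1 → F Γ = 0) :
    ∑ Γ : {Γ : KontsevichGraph n 2 // Γ.IsTree}, F Γ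
      = ∑ t : LabeledRootedTree n, ∑ s, F (t.toKontsevichGraph.flip s) := by
  rw [← Fintype.sum_prod_type']
  symm
  refine Fintype.sum_of_injective (fun a => ⟨_, isTree_flip_toKontsevichGraph a.1 a.2⟩)
    (fun a b h => LabeledRootedTree.flip_toKontsevichGraph_injective (congrArg Subtype.val h))
    _ _ ?_ fun _ => rfl
  rintro ⟨Γ, hΓ⟩ hrange
  refine hF Γ fun hone => hrange ?_
  obtain ⟨t, s, h⟩ := exists_flip_toKontsevichGraph_eq hΓ hone
  exact ⟨(t, s), Subtype.ext h⟩

end Classification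

end KontsevichGraph

section Spray

variable {n d : ℕ}

/-- The vector field `ρ^{aj}(x) p_a ∂_{x^j}` of a bilinear tensor field `ρ`, depending on the
parameter `p`; it is the flat spray `L_V` when `ρ = π`. -/
noncomputable def tensorSpray (ρ : (Fin d → ℝ) → Fin d → Fin d → ℝ) (p : Fin d → ℝ) :
    (Fin d → ℝ) → Fin d → ℝ :=
  fun x j => ∑ a, ρ x a j * p a

theorem contDiff_tensorSpray {ρ : (Fin d → ℝ) → Fin d → Fin d → ℝ}
    (hρ : ∀ j k, ContDiff ℝ ∞ fun y => ρ y j k) (p : Fin d → ℝ) (j : Fin d) :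
    ContDiff ℝ ∞ fun x => tensorSpray ρ p x j :=
  ContDiff.sum fun a _ => (hρ a j).mul contDiff_const

theorem iterPartialDeriv_tensorSpray {ρ : (Fin d → ℝ) → Fin d → Fin d → ℝ}
    (hρ : ∀ j k, ContDiff ℝ ∞ fun y => ρ y j k) (p : Fin d → ℝ) (l : List (Fin d)) (j : Fin d)
    (x : Fin d → ℝ) :
    iterPartialDeriv l (fun y => tensorSpray ρ p y j) x
      = ∑ a, iterPartialDeriv l (fun y => ρ y a j) x * p a := by
  simp only [tensorSpray, mul_comm _ (p _)]
  rw [iterPartialDeriv_sum _ fun a _ => contDiff_const.mul (hρ a j)]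
  simp only [iterPartialDeriv_const_mul]

/-- An index assignment on all edges, split into the indices of the first and of the second edges
of the aerial vertices. -/
def edgeIndexEquiv (n : ℕ) (α : Type*) : (Fin n → α) × (Fin n → α) ≃ (Fin n × Fin 2 → α) where
  toFun c e := ![c.1 e.1, c.2 e.1] e.2
  invFun I := (fun k => I (k, 0), fun k => I (k, 1))
  left_inv _ := rfl
  right_inv I := by
    funext ⟨k, j⟩
    fin_cases j <;> rfl

theorem edgeIndexEquiv_apply_zero {α : Type*} (a b : Fin n → α) (k : Fin n) :
    edgeIndexEquiv n α (a, b) (k, 0) = a k := rfl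

theorem edgeIndexEquiv_apply_one {α : Type*} (a b : Fin n → α) (k : Fin n) :
    edgeIndexEquiv n α (a, b) (k, 1) = b k := rfl

theorem LabeledRootedTree.linearSymbol_toKontsevichGraph
    {ρ : (Fin d → ℝ) → Fin d → Fin d → ℝ} (hρ : ∀ j k, ContDiff ℝ ∞ fun y => ρ y j k)
    (t : LabeledRootedTree n) (i : Fin d) (p x : Fin d → ℝ) :
    t.toKontsevichGraph.linearSymbol ρ i p x = t.elemDiff (tensorSpray ρ p) i x := by
  rw [elemDiff_eq_sum, KontsevichGraph.linearSymbol_eq_sum, ← (edgeIndexEquiv n _).sum_comp,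
    Fintype.sum_prod_type_right]
  refine Finset.sum_congr rfl fun b _ => ?_
  have haerial (a : Fin n → Fin d) (k : Fin n) :
      ((t.toKontsevichGraph.incoming (Sum.inl k)).map (edgeIndexEquiv n _ (a, b))).Perm
        ((t.childList k).map b) := by
    simpa [Function.comp_def, edgeIndexEquiv_apply_one] using
      (t.incoming_inl_perm k).map (edgeIndexEquiv n _ (a, b))
  have hzero (a : Fin n → Fin d) : (((t.toKontsevichGraph.incoming (Sum.inr 0)).map
      (edgeIndexEquiv n _ (a, b))).map p).prod = ∏ k, p (a k) := by
    rw [((t.incoming_inr_zero_perm.map _).map p).prod_eq]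
    simp [Function.comp_def, edgeIndexEquiv_apply_zero, Fin.prod_univ_def]
  have hone (a : Fin n → Fin d) : (t.toKontsevichGraph.incoming (Sum.inr 1)).map
      (edgeIndexEquiv n _ (a, b)) = [i] ↔ b t.root = i := by
    simp [incoming_inr_one, edgeIndexEquiv_apply_one]
  simp only [iterPartialDeriv_perm (hρ _ _) (haerial _ _), hzero, hone,
    edgeIndexEquiv_apply_zero, edgeIndexEquiv_apply_one, ← Finset.prod_mul_distrib,
    iterPartialDeriv_tensorSpray hρ, Finset.prod_univ_sum,
    Fintype.piFinset_univ, mul_ite, mul_one, mul_zero]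
  split_ifs
  · rfl
  · exact Finset.sum_const_zero

end Spray

section Realization

variable {n d : ℕ}

/-- The `i`-th component `∂S_ρ/∂p_{2,i} (p, 0, x)` of the formal realization defined by the
generating function of a bilinear tensor field `ρ`; the Kontsevich realization is the case
`ρ = π / 2`. -/
noncomputable def tensorRealization (ρ : (Fin d → ℝ) → Fin d → Fin d → ℝ) (i : Fin d) :
    ((Fin d → ℝ) → (Fin d → ℝ) → ℝ)⟦X⟧ :=
  PowerSeries.mk fun n p x =>
    partialDeriv i (fun p₂ => PowerSeries.coeff n (generatingFunction ρ) p p₂ x) 0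

theorem coeff_zero_tensorRealization (ρ : (Fin d → ℝ) → Fin d → Fin d → ℝ) (i : Fin d) :
    PowerSeries.coeff 0 (tensorRealization ρ i) = fun _p x => x i := by
  funext p x
  simp only [tensorRealization, generatingFunction, PowerSeries.coeff_mk, if_true,
    add_dotProduct, dotProduct_comm _ x]
  rw [partialDeriv, fderiv_const_add]
  exact partialDeriv_dotProduct x 0 i

open Classical in
theorem sum_weight_mul_linearSymbol {ρ : (Fin d → ℝ) → Fin d → Fin d → ℝ}
    (hρ : ∀ j k, ContDiff ℝ ∞ fun y => ρ y j k) (i : Fin d) (p x : Fin d → ℝ) :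
    ∑ Γ : {Γ : KontsevichGraph n 2 // Γ.IsTree}, Γ.1.weight * Γ.1.linearSymbol ρ i p x
      = ∑ t : LabeledRootedTree n,
        t.toKontsevichGraph.weight * t.elemDiff (tensorSpray (alternation ρ) p) i x := by
  rw [KontsevichGraph.sum_isTree_eq_sum_flip (F := fun Γ => Γ.weight * Γ.linearSymbol ρ i p x)
    fun Γ hΓ => by rw [KontsevichGraph.linearSymbol_eq_zero hΓ, mul_zero]]
  refine Finset.sum_congr rfl fun t _ => ?_
  rw [← t.linearSymbol_toKontsevichGraph (contDiff_alternation hρ),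
    ← KontsevichGraph.sum_sign_mul_linearSymbol_flip hρ, Finset.mul_sum]
  refine Finset.sum_congr rfl fun s _ => ?_
  rw [KontsevichGraph.weight_flip, mul_left_comm, mul_assoc]

theorem coeff_tensorRealization {ρ : (Fin d → ℝ) → Fin d → Fin d → ℝ}
    (hρ : ∀ j k, ContDiff ℝ ∞ fun y => ρ y j k) (i : Fin d) (hn : n ≠ 0) (p x : Fin d → ℝ) :
    PowerSeries.coeff n (tensorRealization ρ i) p x = (∑ t : LabeledRootedTree n,
      t.toKontsevichGraph.weight * t.elemDiff (tensorSpray (alternation ρ) p) i x)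
        / n.factorial := by
  classical
  simp only [tensorRealization, generatingFunction, PowerSeries.coeff_mk, if_neg hn]
  rw [KontsevichGraph.partialDeriv_sum_weight_mul_symbol, sum_weight_mul_linearSymbol hρ,
    one_div_mul_eq_div]

theorem LabeledRootedTree.sum_weight_mul_elemDiff_div_factorial {X : (Fin d → ℝ) → Fin d → ℝ}
    (hX : ∀ u, ContDiff ℝ ∞ fun y => X y u) (u : Fin d) (x : Fin d → ℝ)
    [Fintype (Quotient (LabeledRootedTree.setoid n))]
    {rep : Quotient (LabeledRootedTree.setoid n) → LabeledRootedTree n}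
    (hrep : ∀ T, ⟦rep T⟧ = T) :
    (∑ t : LabeledRootedTree n, t.toKontsevichGraph.weight * t.elemDiff X u x) / n.factorial
      = ∑ T, (rep T).toKontsevichGraph.weight / (rep T).symCard * (rep T).elemDiff X u x := by
  have hinvariant (σ : Equiv.Perm (Fin n)) (t : LabeledRootedTree n) :
      (σ • t).toKontsevichGraph.weight * (σ • t).elemDiff X u x
        = t.toKontsevichGraph.weight * t.elemDiff X u x := by
    rw [toKontsevichGraph_smul, KontsevichGraph.weight_relabel, elemDiff_smul σ t hX]
  have horbits := sum_div_card_eq_sum_quotient (setoid_eq_orbitRel n)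
    (φ := fun t => t.toKontsevichGraph.weight * t.elemDiff X u x) hinvariant hrep
  rw [Nat.card_perm, Nat.card_fin] at horbits
  simp only [horbits, card_stabilizer, div_mul_eq_mul_div]

theorem tensorRealization_sub_C {ρ : (Fin d → ℝ) → Fin d → Fin d → ℝ}
    (hρ : ∀ j k, ContDiff ℝ ∞ fun y => ρ y j k) (i : Fin d)
    (rep : (T : TopRootedTree) → LabeledRootedTree T.degree)
    (hrep : ∀ T : TopRootedTree, T.IsRep (rep T))
    [∀ n, Fintype (Quotient (LabeledRootedTree.setoid n))] :
    tensorRealization ρ i - PowerSeries.C (fun _p x => x i)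
      = PowerSeries.mk fun n => ∑ T : Quotient (LabeledRootedTree.setoid n), fun p x =>
        (rep ⟨n, T⟩).toKontsevichGraph.weight / (rep ⟨n, T⟩).symCard
          * (rep ⟨n, T⟩).elemDiff (tensorSpray (alternation ρ) p) i x := by
  ext n p x
  rw [map_sub, PowerSeries.coeff_C, PowerSeries.coeff_mk, Finset.sum_apply, Finset.sum_apply]
  rcases eq_or_ne n 0 with rfl | hn
  · have : IsEmpty (Quotient (LabeledRootedTree.setoid 0)) :=
      ⟨fun T => (rep ⟨0, T⟩).root.elim0⟩
    simp [coeff_zero_tensorRealization]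
  · rw [if_neg hn, sub_zero, coeff_tensorRealization hρ i hn]
    exact LabeledRootedTree.sum_weight_mul_elemDiff_div_factorial
      (contDiff_tensorSpray (contDiff_alternation hρ) p) i x fun T => hrep ⟨n, T⟩

theorem theorem4_general {ρ : (Fin d → ℝ) → Fin d → Fin d → ℝ}
    (hρ : ∀ j k, ContDiff ℝ ∞ fun y => ρ y j k) (i : Fin d)
    (rep : (T : TopRootedTree) → LabeledRootedTree T.degree)
    (hrep : ∀ T : TopRootedTree, T.IsRep (rep T)) :
    HasSum
      (fun T : TopRootedTree =>
        (PowerSeries.monomial T.degree (fun p x =>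
          (rep T).toKontsevichGraph.weight / ((rep T).symCard : ℝ)
            * (rep T).elemDiff (tensorSpray (alternation ρ) p) i x) :
          ((Fin d → ℝ) → (Fin d → ℝ) → ℝ)⟦X⟧))
      (tensorRealization ρ i - PowerSeries.C (fun _p x => x i)) := by
  classical
  rw [tensorRealization_sub_C hρ i rep hrep]
  exact hasSum_monomial_sigma _

end Realization

theorem PoissonStructure.alternation_coeff_div_two {d : ℕ} (π : PoissonStructure d) :
    alternation (fun y j k => π.coeff y j k / 2) = π.coeff := by
  funext x j k
  rw [alternation, π.antisymm x k j]
  ring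

/-- `s_K^i = x^i + ∑_{T ∈ [RT]} ε^{|T|} (W_T / |sym T|) D_T^i L_V`, where `W_T`, `sym T` and `D_T`
are computed from an arbitrary representative of `T`. -/
theorem theorem4 {d : ℕ} (π : PoissonStructure d) (i : Fin d)
    (rep : (T : TopRootedTree) → LabeledRootedTree T.degree) (hrep : ∀ T : TopRootedTree, T.IsRep (rep T)) :
    HasSum
      (fun T : TopRootedTree =>
        (PowerSeries.monomial T.degree (fun p x =>
          (rep T).toKontsevichGraph.weight / ((rep T).symCard : ℝ)
            * (rep T).elemDiff (π.flatSpray p) i x) :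
          ((Fin d → ℝ) → (Fin d → ℝ) → ℝ)⟦X⟧))
      (kontsevichRealization π i - PowerSeries.C (fun _p x => x i)) := by
  have h := theorem4_general (fun j k => (π.smooth j k).div_const 2) i rep hrep
  rwa [π.alternation_coeff_div_two] at h
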